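/- Let $K$ be a field and let $L(A,B)$ be the free Lie algebra over $K$ on two generators $A$, $B$. Give $A$ degree $2$, $B$ degree $0$, and every formal bracket $[Y,Z]$ of bracket monomials degree $\max(\deg Y+\deg Z-1,\,0)$; let $L^n(A,B)$ be the span of the bracket monomials of degree $n$. Let $\mathcal I$ be the Lie ideal generated by $[L^0(A,B),L^0(A,B)]$, let $L_{\mathfrak P}(A,B)=L(A,B)/\mathcal I$ be the Lie algebra of classical mechanics, and let $L^n_{\mathfrak P}(A,B)$ be the image of $L^n(A,B)$. Say that a Lie algebra $R$ is of class $\mathfrak P$ if it is graded, $R=\bigoplus_{n\ge 0}R_n$, with $[R_n,R_m]\subseteq R_{n+m-1}$ whenever $n>0$ or $m>0$, and $[R_0,R_0]=0$. Let $U_1*U_2:=[U_2,[U_1,A]]$, and let $X\subset L_{\mathfrak P}(A,B)$ be the smallest set that contains $B$ and is closed under $*$, so that $X=\{B,\ B*B,\ (B*B)*B,\dots\}$. Then: 1. With the grading $L_{\mathfrak P}(A,B)=\bigoplus_{n\ge0}L^n_{\mathfrak P}(A,B)$, the Lie algebra $L_{\mathfrak P}(A,B)$ is the free Lie algebra in the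 class $\mathfrak P$ over $A$ (of degree $2$) and $B$ (of degree $0$): it is of class $\mathfrak P$, it is generated by $A\in L^2_{\mathfrak P}(A,B)$ and $B\in L^0_{\mathfrak P}(A,B)$, and for every Lie algebra $R$ of class $\mathfrak P$, $a\in R_2$ and $b\in R_0$, there is a unique degree-preserving homomorphism of Lie algebras $L_{\mathfrak P}(A,B)\to R$ with $A\mapsto a$, $B\mapsto b$. 2. As a vector space, $L_{\mathfrak P}(A,B)=\operatorname{span}(X)\oplus L(A,[X,A])$, where $L(A,[X,A])$ is the Lie subalgebra generated by $A$ and the elements $[U,A]$, $U\in X$. 3. $\operatorname{span}(X)$ is abelian and is the subspace $L^0_{\mathfrak P}(A,B)$ of degree $0$. It is closed under $*$, and with this operation it is isomorphic to the free commutative nonassociative $K$-algebra on one generator, the generator corresponding to $B$ and the monomials of the free algebra (one for each rooted full binary tree) corresponding to the elements of $X$. 4. The Lie algebra $L(A,[X,A])$ is free over the generators $A$ and $[U,A]$, $U\in X$ (distinct $U$ giving distinct free generators). -/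

import Mathlib

noncomputable section

namespace ClassicalMech

/-! ### Lie algebras of class `𝔓` -/

/-- A grading `L = ⨁ₙ Lₙ` making `L` a polynomially graded Lie algebra: `[Lₙ, Lₘ] ⊆ Lₙ₊ₘ₋₁`
if `n > 0` or `m > 0`, and `[L₀, L₀] = 0`. -/
structure IsClassP (K : Type*) {L : Type*} [Field K] [LieRing L] [LieAlgebra K L]
    (𝒢 : ℕ → Submodule K L) : Prop where
  isInternal : DirectSum.IsInternal 𝒢
  lie_mem : ∀ n m : ℕ, 0 < n ∨ 0 < m → ∀ x ∈ 𝒢 n, ∀ y ∈ 𝒢 m, ⁅x, y⁆ ∈ 𝒢 (n + m - 1)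
  lie_zero : ∀ x ∈ 𝒢 0, ∀ y ∈ 𝒢 0, ⁅x, y⁆ = 0

/-- `L`, with the grading `𝒢`, is free in the class `𝔓` over the family `g` whose members have the
prescribed degrees `d`: it is of class `𝔓`, it is generated by `g`, and each degree-respecting
assignment of the generators into a Lie algebra `R` of class `𝔓` extends to a unique
degree-preserving homomorphism of Lie algebras. -/
structure IsFreeOfClassP.{u, v, v', w} (K : Type u) {L : Type v} {ι : Type v'} [Field K]
    [LieRing L] [LieAlgebra K L] (𝒢 : ℕ → Submodule K L) (d : ι → ℕ) (g : ι → L) : Prop where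
  isClassP : IsClassP K 𝒢
  gen_mem : ∀ i, g i ∈ 𝒢 (d i)
  generates : LieSubalgebra.lieSpan K L (Set.range g) = ⊤
  existsUnique_lift : ∀ (R : Type w) [LieRing R] [LieAlgebra K R] (ℛ : ℕ → Submodule K R),
    IsClassP K ℛ → ∀ r : ι → R, (∀ i, r i ∈ ℛ (d i)) →
      ∃! f : L →ₗ⁅K⁆ R, (∀ n, ∀ x ∈ 𝒢 n, f x ∈ ℛ n) ∧ ∀ i, f (g i) = r i

/-! ### The Lie algebra of classical mechanics -/

/-- The two generators. -/
inductive Gen : Type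
  | A
  | B

/-- The degrees of the generators. -/
def Gen.degree : Gen → ℕ
  | .A => 2
  | .B => 0

/-- The degree of a formal bracket: `degree [Y, Z] = max (degree Y + degree Z - 1) 0`
(the subtraction of natural numbers is truncated). -/
def degree : FreeMagma Gen → ℕ
  | .of x => x.degree
  | .mul y z => degree y + degree z - 1

section
variable (K : Type*) [Field K]

/-- The element of the free Lie algebra `L(A, B)` given by a formal bracket. -/
def monomial : FreeMagma Gen → FreeLieAlgebra K Gen
  | .of x => FreeLieAlgebra.of K x
  | .mul y z => ⁅monomial y, monomial z⁆

/-- `Lⁿ(A, B)`: the span of the bracket monomials of degree `n`. -/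
def freeDeg (n : ℕ) : Submodule K (FreeLieAlgebra K Gen) :=
  Submodule.span K {x | ∃ t : FreeMagma Gen, degree t = n ∧ monomial K t = x}

/-- The Lie ideal generated by `[L⁰(A, B), L⁰(A, B)]`. -/
def idealI : LieIdeal K (FreeLieAlgebra K Gen) :=
  LieSubmodule.lieSpan K (FreeLieAlgebra K Gen)
    {z | ∃ x ∈ freeDeg K 0, ∃ y ∈ freeDeg K 0, ⁅x, y⁆ = z}

/-- The Lie algebra of classical mechanics `L_𝔓(A, B) = L(A, B) / I`. -/
abbrev LP : Type _ := FreeLieAlgebra K Gen ⧸ idealI K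

/-- The images of the generators in `L_𝔓(A, B)`. -/
def gen (x : Gen) : LP K := LieSubmodule.Quotient.mk' (idealI K) (FreeLieAlgebra.of K x)

/-- The degree-`n` subspace of `L_𝔓(A, B)`. -/
def degLP (n : ℕ) : Submodule K (LP K) :=
  (freeDeg K n).map (LieSubmodule.Quotient.mk' (idealI K) : FreeLieAlgebra K Gen →ₗ[K] LP K)

/-- The operation `U₁ * U₂ = [U₂, [U₁, A]]`. -/
def starOp (U₁ U₂ : LP K) : LP K := ⁅U₂, ⁅U₁, gen K .A⁆⁆

/-- Membership in the set `X = {B, B * B, (B * B) * B, …}`. -/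
inductive MemX : LP K → Prop
  | base : MemX (gen K .B)
  | star (U₁ U₂ : LP K) : MemX U₁ → MemX U₂ → MemX (starOp K U₁ U₂)

/-- The set `X`: the closure of `{B}` under `*`. -/
def setX : Set (LP K) := {U | MemX K U}

/-- The subspace `span(X)`. -/
def spanX : Submodule K (LP K) := Submodule.span K (setX K)

/-- The family consisting of `A` and of `[U, A]` for `U ∈ X`. -/
def freeGen : Option (setX K) → LP K
  | none => gen K .A
  | some U => ⁅(U : LP K), gen K .A⁆

/-- The Lie subalgebra of `L_𝔓(A, B)` generated by `A` and `[X, A]`. -/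
def subalgAXA : LieSubalgebra K (LP K) :=
  LieSubalgebra.lieSpan K (LP K) ({gen K .A} ∪ {z | ∃ U ∈ setX K, ⁅U, gen K .A⁆ = z})

end

/-! ### The free commutative nonassociative algebra on one generator -/

/-- The free commutative magma on one generator, that is, the set of rooted full binary trees:
the free magma modulo the smallest congruence that identifies `s * t` with `t * s`. -/
abbrev CommTree : Type :=
  (conGen fun a b : FreeMagma Unit => ∃ s t, a = s * t ∧ b = t * s).Quotient

/-- The tree with one node, the generator of the magma. -/
def CommTree.leaf : CommTree := Con.toQuotient (FreeMagma.of ())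

/-- The free commutative nonassociative (nonunital) algebra on one generator: the algebra of the
free commutative magma. -/
abbrev FreeCommAlg (K : Type*) [Field K] : Type _ := MonoidAlgebra K CommTree

end ClassicalMech

end

universe u w

/-!
The proof compares `L_𝔓(A, B)` with an explicit model in which the asserted structure is visible.

Let `T` be the free commutative magma on one generator, `V` its algebra over `K`, and `F` the free
Lie algebra on symbols `A` and `[t, A]`, `t ∈ T`. In `L_𝔓(A, B)` one expects `V` to be abelian, `F`
to be a subalgebra, and `[t, [s, A]] = s * t`. The bracket of `f ∈ F` and `u ∈ V` then has a component
in `V`, which is an action of `F` on `V` (`treeAction`), and a component in `F`, which is a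
derivation of `F` into `Hom(V, F)` (`treeDer`). Since `F` is free, both exist and are determined by
their values on the generators. The Jacobi identity on `V ⊕ F` (`Model`) reduces to the symmetry of `[[f, u], v]` in
`u, v ∈ V`, which is an induction on `f` that starts from the commutativity of the product of `V`
(`treeDer_lie_symm`, `treeDer_treeDer_symm`). No embedding of a free Lie algebra into its enveloping
algebra is needed.

The model is filtered by the number of brackets with elements of `V` that lead into `V`
(`Model.filtration`). The levels satisfy the bracket relations of the class `𝔓`, and `exists_liftLP`
gives a homomorphism from `L_𝔓(A, B)` to the model that maps degree `0` into `V`. It has an inverse: trees are evaluated at `B` with `*`, which is well defined because `*` is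
commutative in degree `0`, and `F` is mapped by its universal property (`exists_modelEquiv`). The
decomposition, the description of `span(X)` and the freeness of `L(A, [X, A])` are read off from the
model.

For the first assertion, `exists_liftLP` is the universal property, and the only other point is that
the sum of the `Lⁿ` is direct. The same universal property yields a homomorphism to
`K[T;T⁻¹] ⊗ L_𝔓(A, B)` that multiplies `Lⁿ` by `T ^ (n - 1)` (`exists_gradingHom`), and the
coefficients of `T` separate the degrees.
-/

noncomputable section

namespace ClassicalMech

/-! ### Induction and derivations on free Lie algebras -/

section FreeLie

attribute [local instance] LieRing.ofAssociativeRing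

variable {R : Type*} [CommRing R] {S : Type*}

theorem freeLie_induction {p : FreeLieAlgebra R S → Prop}
    (of : ∀ s, p (FreeLieAlgebra.of R s)) (zero : p 0) (add : ∀ x y, p x → p y → p (x + y))
    (smul : ∀ (c : R) x, p x → p (c • x)) (lie : ∀ x y, p x → p y → p ⁅x, y⁆)
    (x : FreeLieAlgebra R S) : p x := by
  let P : LieSubalgebra R (FreeLieAlgebra R S) :=
    { carrier := {x | p x}
      add_mem' := fun hx hy => add _ _ hx hy
      zero_mem' := zero
      smul_mem' := fun c x hx => smul c x hx
      lie_mem' := fun hx hy => lie _ _ hx hy }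
  let f : FreeLieAlgebra R S →ₗ⁅R⁆ P := FreeLieAlgebra.lift R fun s => ⟨FreeLieAlgebra.of R s, of s⟩
  have hf : P.incl.comp f = LieHom.id := by
    ext s
    simp [f]
  have := (f x).2
  rwa [show ((f x : P) : FreeLieAlgebra R S) = x from LieHom.congr_fun hf x] at this

theorem range_lift {L : Type*} [LieRing L] [LieAlgebra R L] (g : S → L) :
    (FreeLieAlgebra.lift R g).range = LieSubalgebra.lieSpan R L (Set.range g) := by
  apply le_antisymm
  · rintro _ ⟨x, rfl⟩
    change FreeLieAlgebra.lift R g x ∈ _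
    induction x using freeLie_induction with
    | of s => rw [FreeLieAlgebra.lift_of_apply]; exact LieSubalgebra.subset_lieSpan ⟨s, rfl⟩
    | zero => rw [map_zero]; exact zero_mem _
    | add x y hx hy => rw [map_add]; exact add_mem hx hy
    | smul c x hx => rw [map_smul]; exact LieSubalgebra.smul_mem _ c hx
    | lie x y hx hy => rw [LieHom.map_lie]; exact LieSubalgebra.lie_mem _ hx hy
  · rw [LieSubalgebra.lieSpan_le]
    rintro _ ⟨s, rfl⟩
    exact ⟨FreeLieAlgebra.of R s, FreeLieAlgebra.lift_of_apply g s⟩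

variable {M : Type*} [AddCommGroup M] [Module R M] [LieRingModule (FreeLieAlgebra R S) M]
  [LieModule R (FreeLieAlgebra R S) M]

/-- The action of the free Lie algebra on the extension `M × R` of the trivial module `R` by `M` in
which a generator `s` sends `(m, c)` to `(⁅s, m⁆ + c • g s, 0)`. Such extensions correspond to
derivations into `M`; this replaces the semidirect sum of the free Lie algebra with `M`. -/
def derivationHom (g : S → M) : FreeLieAlgebra R S →ₗ⁅R⁆ Module.End R (M × R) :=
  FreeLieAlgebra.lift R fun s =>
    LinearMap.inl R M R ∘ₗ
      (LieModule.toEnd R (FreeLieAlgebra R S) M (FreeLieAlgebra.of R s)).coprod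
        (LinearMap.toSpanSingleton R M (g s))

theorem derivationHom_apply (g : S → M) (x : FreeLieAlgebra R S) (m : M) (c : R) :
    derivationHom g x (m, c) = (⁅x, m⁆ + c • (derivationHom g x (0, 1)).1, 0) := by
  induction x using freeLie_induction generalizing m c with
  | of s => simp [derivationHom]
  | zero => simp [Prod.ext_iff]
  | add x y hx hy =>
    rw [map_add, LinearMap.add_apply, LinearMap.add_apply, hx, hy, Prod.mk_add_mk, add_lie,
      Prod.fst_add, smul_add, add_zero, add_add_add_comm]
  | smul a x hx =>
    rw [map_smul, LinearMap.smul_apply, LinearMap.smul_apply, hx m c]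
    simp [smul_comm a c]
  | lie x y hx hy =>
    rw [LieHom.map_lie, LieRing.of_associative_ring_bracket]
    simp only [LinearMap.sub_apply, Module.End.mul_apply]
    rw [hy m c, hx m c, hx _ 0, hy _ 0, hx 0 1, hy 0 1, hx _ 0, hy _ 0]
    simp [smul_sub]
    abel

/-- The derivation of a free Lie algebra into a module with prescribed values on the generators. -/
def liftDerivation (g : S → M) : LieDerivation R (FreeLieAlgebra R S) M where
  toFun x := (derivationHom g x (0, 1)).1
  map_add' x y := by simp
  map_smul' c x := by simp
  leibniz' x y := by
    simp only [LinearMap.coe_mk, AddHom.coe_mk]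
    rw [LieHom.map_lie, LieRing.of_associative_ring_bracket]
    simp only [LinearMap.sub_apply, Module.End.mul_apply]
    rw [derivationHom_apply g y 0 1, derivationHom_apply g x 0 1, derivationHom_apply g x _ 0,
      derivationHom_apply g y _ 0]
    simp

theorem liftDerivation_of (g : S → M) (s : S) :
    liftDerivation g (FreeLieAlgebra.of R s) = g s := by
  change (derivationHom g _ (0, 1)).1 = _
  simp [derivationHom]

end FreeLie

/-! ### The action of the free Lie algebra on the tree algebra, and its cocycle -/

section TreeAction

variable {K T : Type*} [Field K]

/-- The linear map that sends the tree `t` to the generator `some t`. The generators of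
`FreeLieAlgebra K (Option T)` stand for `A` (`none`) and `[t, A]` (`some t`), so that this is the
bracket `u ↦ [u, A]`. -/
def bracketA : MonoidAlgebra K T →ₗ[K] FreeLieAlgebra K (Option T) :=
  (MonoidAlgebra.basis T K).constr K fun t => FreeLieAlgebra.of K (some t)

theorem bracketA_single (t : T) :
    bracketA (MonoidAlgebra.single t 1 : MonoidAlgebra K T) = FreeLieAlgebra.of K (some t) := by
  rw [← MonoidAlgebra.basis_apply, bracketA, Module.Basis.constr_basis]

theorem treeAlg_induction {p : MonoidAlgebra K T → Prop}
    (single : ∀ t, p (MonoidAlgebra.single t 1)) (zero : p 0) (add : ∀ u v, p u → p v → p (u + v)) (smul : ∀ (c : K) u, p u → p (c • u))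
    (u : MonoidAlgebra K T) : p u := by
  induction u using MonoidAlgebra.induction_linear with
  | zero => exact zero
  | add u v hu hv => exact add u v hu hv
  | single t c =>
    have := smul c _ (single t)
    rwa [MonoidAlgebra.smul_single, smul_eq_mul, mul_one] at this

variable [CommMagma T]

attribute [local instance 100] LieRing.ofAssociativeRing

variable (K T) in
/-- The action of `FreeLieAlgebra K (Option T)` on the tree algebra by `A · u = 0` and
`[t, A] · u = -(t * u)`. It is the bracket with `u` modulo the subalgebra of positive degree: in
`L_𝔓(A, B)`, `[A, u]` has positive degree and `[[t, A], u] = -[u, [t, A]] = -(t * u)`. -/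
def treeAction : FreeLieAlgebra K (Option T) →ₗ⁅K⁆ Module.End K (MonoidAlgebra K T) :=
  FreeLieAlgebra.lift K fun s =>
    s.elim 0 fun t => -LinearMap.mulLeft K (MonoidAlgebra.single t 1 : MonoidAlgebra K T)

variable (K T) in
/-- The module structure given by `treeAction`. -/
instance : LieRingModule (FreeLieAlgebra K (Option T)) (MonoidAlgebra K T) :=
  LieRingModule.compLieHom (MonoidAlgebra K T) (treeAction K T)

variable (K T) in
instance : LieModule K (FreeLieAlgebra K (Option T)) (MonoidAlgebra K T) :=
  LieModule.compLieHom (MonoidAlgebra K T) (treeAction K T)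

theorem of_none_lie (u : MonoidAlgebra K T) :
    ⁅(FreeLieAlgebra.of K none : FreeLieAlgebra K (Option T)), u⁆ = 0 := by
  change treeAction K T _ u = 0
  simp [treeAction]

theorem of_some_lie (t : T) (u : MonoidAlgebra K T) :
    ⁅(FreeLieAlgebra.of K (some t) : FreeLieAlgebra K (Option T)), u⁆ =
      -(MonoidAlgebra.single t 1 * u) := by
  change treeAction K T _ u = _
  simp [treeAction]

theorem treeAlg_mul_comm (u v : MonoidAlgebra K T) : u * v = v * u := by
  induction u using MonoidAlgebra.induction_linear with
  | zero => simp
  | add u₁ u₂ h₁ h₂ => rw [add_mul, mul_add, h₁, h₂]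
  | single s a =>
    induction v using MonoidAlgebra.induction_linear with
    | zero => simp
    | add v₁ v₂ h₁ h₂ => rw [add_mul, mul_add, h₁, h₂]
    | single t b =>
      rw [MonoidAlgebra.single_mul_single, MonoidAlgebra.single_mul_single, mul_comm s, mul_comm a]

theorem bracketA_lie (u v : MonoidAlgebra K T) : ⁅bracketA u, v⁆ = -(u * v) := by
  induction u using treeAlg_induction with
  | single t => rw [bracketA_single, of_some_lie]
  | zero => simp
  | add u₁ u₂ h₁ h₂ => rw [map_add, add_lie, h₁, h₂, add_mul, neg_add]
  | smul c u h => rw [map_smul, smul_lie, h, smul_mul_assoc, smul_neg]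

variable (K T) in
/-- The derivation `f ↦ (u ↦ the part of [f, u] of positive degree)`. It is determined by its values
`u ↦ -[u, A]` at `A` and `0` at `[t, A]`. -/
def treeDer : LieDerivation K (FreeLieAlgebra K (Option T))
    (MonoidAlgebra K T →ₗ[K] FreeLieAlgebra K (Option T)) :=
  liftDerivation fun s => s.elim (-bracketA) fun _ => 0

theorem treeDer_of_none (u : MonoidAlgebra K T) :
    treeDer K T (FreeLieAlgebra.of K none) u = -bracketA u := by
  simp [treeDer, liftDerivation_of]

theorem treeDer_of_some (t : T) : treeDer K T (FreeLieAlgebra.of K (some t)) = 0 := by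
  simp [treeDer, liftDerivation_of]

theorem treeDer_bracketA (u : MonoidAlgebra K T) : treeDer K T (bracketA u) = 0 := by
  induction u using treeAlg_induction with
  | single t => rw [bracketA_single, treeDer_of_some]
  | zero => simp
  | add u₁ u₂ h₁ h₂ => rw [map_add, map_add, h₁, h₂, add_zero]
  | smul c u h => rw [map_smul, map_smul, h, smul_zero]

theorem treeDer_lie (f g : FreeLieAlgebra K (Option T)) (u : MonoidAlgebra K T) :
    treeDer K T ⁅f, g⁆ u =
      ⁅f, treeDer K T g u⁆ - treeDer K T g ⁅f, u⁆ -
        (⁅g, treeDer K T f u⁆ - treeDer K T f ⁅g, u⁆) := by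
  rw [LieDerivation.apply_lie_eq_sub, LinearMap.sub_apply, LieHom.lie_apply, LieHom.lie_apply]

/-- One half of the symmetry `[[f, u], v] = [[f, v], u]`, which is the Jacobi identity for the
commuting elements `u` and `v`: the part of degree `0`. At `A` it is the commutativity of the
product. -/
theorem treeDer_lie_symm (f : FreeLieAlgebra K (Option T)) (u v : MonoidAlgebra K T) :
    ⁅treeDer K T f u, v⁆ = ⁅treeDer K T f v, u⁆ := by
  induction f using freeLie_induction generalizing u v with
  | of s =>
    cases s with
    | none =>
      rw [treeDer_of_none, treeDer_of_none, neg_lie, neg_lie, bracketA_lie, bracketA_lie,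
        treeAlg_mul_comm]
    | some t => simp [treeDer_of_some]
  | zero => simp
  | add f g hf hg =>
    rw [map_add, LinearMap.add_apply, LinearMap.add_apply, add_lie, add_lie, hf, hg]
  | smul c f hf => rw [map_smul, LinearMap.smul_apply, LinearMap.smul_apply, smul_lie, smul_lie, hf]
  | lie f g hf hg =>
    simp only [treeDer_lie, sub_lie, lie_lie]
    rw [hg ⁅f, u⁆ v, hg ⁅f, v⁆ u, hf ⁅g, u⁆ v, hf ⁅g, v⁆ u, hg u v, hf u v]
    abel

/-- The part of positive degree of the symmetry `[[f, u], v] = [[f, v], u]`. -/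
theorem treeDer_treeDer_symm (f : FreeLieAlgebra K (Option T)) (u v : MonoidAlgebra K T) :
    treeDer K T (treeDer K T f u) v = treeDer K T (treeDer K T f v) u := by
  induction f using freeLie_induction generalizing u v with
  | of s =>
    cases s with
    | none => simp [treeDer_of_none, treeDer_bracketA]
    | some t => simp [treeDer_of_some]
  | zero => simp
  | add f g hf hg => simp only [map_add, LinearMap.add_apply, hf u v, hg u v]
  | smul c f hf => simp only [map_smul, LinearMap.smul_apply, hf u v]
  | lie f g hf hg =>
    simp only [treeDer_lie, map_sub, LinearMap.sub_apply]
    rw [hg ⁅f, u⁆ v, hg ⁅f, v⁆ u, hf ⁅g, u⁆ v, hf ⁅g, v⁆ u, hg u v, hf u v,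
      treeDer_lie_symm g u v, treeDer_lie_symm f u v,
      ← lie_skew (treeDer K T g u) (treeDer K T f v),
      ← lie_skew (treeDer K T g v) (treeDer K T f u)]
    abel

end TreeAction

/-! ### The model Lie algebra -/

section Model

variable (K T : Type*) [Field K]

/-- The model of the Lie algebra of classical mechanics: the direct sum of the tree algebra, which
is an abelian subalgebra, and of the free Lie algebra on `A` and the `[t, A]`, which is a subalgebra.
The mixed bracket is `[f, u] = f · u + treeDer f u`. -/
@[ext]
structure Model where
  /-- The component of degree `0`, a function of the positions. -/
  pos : MonoidAlgebra K T
  /-- The component of positive degree in the momenta. -/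
  mom : FreeLieAlgebra K (Option T)

namespace Model

variable {K T}

/-- As a type, the model is a product. -/
def equivProd : Model K T ≃ MonoidAlgebra K T × FreeLieAlgebra K (Option T) where
  toFun x := (x.pos, x.mom)
  invFun x := ⟨x.1, x.2⟩
  left_inv _ := rfl
  right_inv _ := rfl

instance : AddCommGroup (Model K T) := equivProd.addCommGroup

instance : Module K (Model K T) := equivProd.module K

@[simp] theorem pos_zero : (0 : Model K T).pos = 0 := rfl
@[simp] theorem mom_zero : (0 : Model K T).mom = 0 := rfl
@[simp] theorem pos_add (x y : Model K T) : (x + y).pos = x.pos + y.pos := rfl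
@[simp] theorem mom_add (x y : Model K T) : (x + y).mom = x.mom + y.mom := rfl
@[simp] theorem pos_smul (c : K) (x : Model K T) : (c • x).pos = c • x.pos := rfl
@[simp] theorem mom_smul (c : K) (x : Model K T) : (c • x).mom = c • x.mom := rfl

variable [CommMagma T]

instance : Bracket (Model K T) (Model K T) where
  bracket x y := ⟨⁅x.mom, y.pos⁆ - ⁅y.mom, x.pos⁆,
    ⁅x.mom, y.mom⁆ + treeDer K T x.mom y.pos - treeDer K T y.mom x.pos⟩

@[simp] theorem pos_lie (x y : Model K T) : ⁅x, y⁆.pos = ⁅x.mom, y.pos⁆ - ⁅y.mom, x.pos⁆ := rfl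

@[simp] theorem mom_lie (x y : Model K T) :
    ⁅x, y⁆.mom = ⁅x.mom, y.mom⁆ + treeDer K T x.mom y.pos - treeDer K T y.mom x.pos := rfl

instance : LieRing (Model K T) where
  add_lie x y z := by ext <;> simp <;> abel
  lie_add x y z := by ext <;> simp <;> abel
  lie_self x := by ext <;> simp
  leibniz_lie x y z := by
    ext
    · simp only [pos_lie, mom_lie, pos_add, lie_sub, sub_lie, add_lie, lie_lie]
      rw [treeDer_lie_symm x.mom z.pos y.pos, treeDer_lie_symm y.mom z.pos x.pos,
        treeDer_lie_symm z.mom y.pos x.pos]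
      abel_nf
    · simp only [pos_lie, mom_lie, mom_add, lie_sub, sub_lie, add_lie, lie_add, lie_lie, map_add,
        map_sub, treeDer_lie, LinearMap.sub_apply, LinearMap.add_apply]
      rw [treeDer_treeDer_symm x.mom z.pos y.pos, treeDer_treeDer_symm y.mom z.pos x.pos,
        treeDer_treeDer_symm z.mom y.pos x.pos]
      rw [← lie_skew z.mom (treeDer K T x.mom y.pos), ← lie_skew z.mom (treeDer K T y.mom x.pos)]
      abel

instance : LieAlgebra K (Model K T) where
  lie_smul c x y := by ext <;> simp [smul_sub, smul_add]

end Model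
end Model

/-! ### The grading and the universal property -/

section Grading

variable {K : Type*} [Field K]

/-- The image in `L_𝔓(A, B)` of a formal bracket. -/
def monomialLP (K : Type*) [Field K] (t : FreeMagma Gen) : LP K :=
  LieSubmodule.Quotient.mk' (idealI K) (monomial K t)

theorem mk'_surjective : Function.Surjective (LieSubmodule.Quotient.mk' (idealI K)) :=
  LieSubmodule.Quotient.surjective_mk' _

theorem mk'_lie (x y : FreeLieAlgebra K Gen) :
    LieSubmodule.Quotient.mk' (idealI K) ⁅x, y⁆ =
      ⁅LieSubmodule.Quotient.mk' (idealI K) x, LieSubmodule.Quotient.mk' (idealI K) y⁆ :=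
  rfl

theorem monomialLP_mem (t : FreeMagma Gen) : monomialLP K t ∈ degLP K (degree t) :=
  Submodule.mem_map_of_mem (Submodule.subset_span ⟨t, rfl, rfl⟩)

theorem degLP_eq_span (n : ℕ) :
    degLP K n = Submodule.span K {x | ∃ t, degree t = n ∧ monomialLP K t = x} := by
  rw [degLP, freeDeg, Submodule.map_span]
  congr 1
  ext x
  constructor
  · rintro ⟨_, ⟨t, ht, rfl⟩, rfl⟩
    exact ⟨t, ht, rfl⟩
  · rintro ⟨t, ht, rfl⟩
    exact ⟨_, ⟨t, ht, rfl⟩, rfl⟩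

theorem gen_mem_degLP (s : Gen) : gen K s ∈ degLP K s.degree :=
  monomialLP_mem (K := K) (FreeMagma.of s)

theorem degLP_zero_lie {x y : LP K} (hx : x ∈ degLP K 0) (hy : y ∈ degLP K 0) : ⁅x, y⁆ = 0 := by
  obtain ⟨x, hx, rfl⟩ := hx
  obtain ⟨y, hy, rfl⟩ := hy
  exact (LieSubmodule.Quotient.mk_eq_zero (N := idealI K)).2
    (LieSubmodule.subset_lieSpan ⟨x, hx, y, hy, rfl⟩)

theorem degLP_lie_mem {n m : ℕ} {x y : LP K} (hx : x ∈ degLP K n) (hy : y ∈ degLP K m) :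
    ⁅x, y⁆ ∈ degLP K (n + m - 1) := by
  rw [degLP_eq_span] at hx hy
  induction hx using Submodule.span_induction with
  | mem x h =>
    obtain ⟨t, rfl, rfl⟩ := h
    induction hy using Submodule.span_induction with
    | mem y h =>
      obtain ⟨s, rfl, rfl⟩ := h
      exact monomialLP_mem (K := K) (t * s)
    | zero => rw [lie_zero]; exact zero_mem _
    | add _ _ _ _ h₁ h₂ => rw [lie_add]; exact add_mem h₁ h₂
    | smul c _ _ h => rw [lie_smul]; exact Submodule.smul_mem _ c h
  | zero => rw [zero_lie]; exact zero_mem _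
  | add _ _ _ _ h₁ h₂ => rw [add_lie]; exact add_mem h₁ h₂
  | smul c _ _ h => rw [smul_lie]; exact Submodule.smul_mem _ c h

theorem LP_induction {p : LP K → Prop} (gen : ∀ s, p (gen K s)) (zero : p 0)
    (add : ∀ x y, p x → p y → p (x + y)) (smul : ∀ (c : K) x, p x → p (c • x))
    (lie : ∀ x y, p x → p y → p ⁅x, y⁆) (x : LP K) : p x := by
  obtain ⟨x, rfl⟩ := mk'_surjective x
  induction x using freeLie_induction with
  | of s => exact gen s
  | zero => rwa [map_zero]
  | add x y hx hy => rw [map_add]; exact add _ _ hx hy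
  | smul c x hx => rw [map_smul]; exact smul c _ hx
  | lie x y hx hy => rw [mk'_lie]; exact lie _ _ hx hy

theorem lieSpan_gen : LieSubalgebra.lieSpan K (LP K) (Set.range (gen K)) = ⊤ := by
  rw [eq_top_iff]
  intro x _
  induction x using LP_induction with
  | gen s => exact LieSubalgebra.subset_lieSpan ⟨s, rfl⟩
  | zero => exact zero_mem _
  | add x y hx hy => exact add_mem (hx trivial) (hy trivial)
  | smul c x hx => exact LieSubalgebra.smul_mem _ c (hx trivial)
  | lie x y hx hy => exact LieSubalgebra.lie_mem _ (hx trivial) (hy trivial)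

variable {L : Type*} [LieRing L] [LieAlgebra K L]

theorem LP_hom_ext {f g : LP K →ₗ⁅K⁆ L} (h : ∀ s, f (gen K s) = g (gen K s)) : f = g := by
  ext x
  induction x using LP_induction with
  | gen s => exact h s
  | zero => simp
  | add _ _ h₁ h₂ => rw [map_add, map_add, h₁, h₂]
  | smul c _ h => rw [map_smul, map_smul, h]
  | lie _ _ h₁ h₂ => rw [LieHom.map_lie, LieHom.map_lie, h₁, h₂]

/-- The universal property of `L_𝔓(A, B)`. The subspaces `𝒢 n` need neither be independent nor
span. -/
theorem exists_liftLP {𝒢 : ℕ → Submodule K L}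
    (lie_mem : ∀ n m : ℕ, 0 < n ∨ 0 < m → ∀ x ∈ 𝒢 n, ∀ y ∈ 𝒢 m, ⁅x, y⁆ ∈ 𝒢 (n + m - 1))
    (lie_zero : ∀ x ∈ 𝒢 0, ∀ y ∈ 𝒢 0, ⁅x, y⁆ = 0) {r : Gen → L} (hr : ∀ s, r s ∈ 𝒢 s.degree) :
    ∃ f : LP K →ₗ⁅K⁆ L, (∀ n, ∀ x ∈ degLP K n, f x ∈ 𝒢 n) ∧ ∀ s, f (gen K s) = r s := by
  let F := FreeLieAlgebra.lift K r
  have hmon (t : FreeMagma Gen) : F (monomial K t) ∈ 𝒢 (degree t) := by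
    induction t with
    | ih1 s =>
      change F (FreeLieAlgebra.of K s) ∈ 𝒢 s.degree
      rw [FreeLieAlgebra.lift_of_apply]
      exact hr s
    | ih2 y z hy hz =>
      change F ⁅monomial K y, monomial K z⁆ ∈ 𝒢 (degree y + degree z - 1)
      rw [LieHom.map_lie]
      -- The truncation in `degree` matters only if both degrees vanish, and then the bracket does.
      by_cases h : 0 < degree y ∨ 0 < degree z
      · exact lie_mem _ _ h _ hy _ hz
      · rw [lie_zero _ (by convert hy; omega) _ (by convert hz; omega)]
        exact zero_mem _
  have hdeg (n : ℕ) : freeDeg K n ≤ (𝒢 n).comap (F : FreeLieAlgebra K Gen →ₗ[K] L) := by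
    rw [freeDeg, Submodule.span_le]
    rintro _ ⟨t, rfl, rfl⟩
    exact hmon t
  have hker : idealI K ≤ F.ker := by
    rw [idealI, LieSubmodule.lieSpan_le]
    rintro _ ⟨x, hx, y, hy, rfl⟩
    rw [SetLike.mem_coe, LieHom.mem_ker, LieHom.map_lie]
    exact lie_zero _ (hdeg 0 hx) _ (hdeg 0 hy)
  let f : LP K →ₗ[K] L := (idealI K).toSubmodule.liftQ (F : FreeLieAlgebra K Gen →ₗ[K] L) hker
  have hf (x) : f (LieSubmodule.Quotient.mk' (idealI K) x) = F x := rfl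
  refine ⟨{ f with map_lie' := ?_ }, ?_, ?_⟩
  · intro x y
    obtain ⟨x, rfl⟩ := mk'_surjective x
    obtain ⟨y, rfl⟩ := mk'_surjective y
    exact F.map_lie x y
  · rintro n _ ⟨x, hx, rfl⟩
    exact hdeg n hx
  · intro s
    exact FreeLieAlgebra.lift_of_apply r s

theorem iSup_degLP : ⨆ n, degLP K n = ⊤ := by
  refine eq_top_iff.2 fun x _ => ?_
  induction x using LP_induction with
  | gen s => exact Submodule.mem_iSup_of_mem _ (gen_mem_degLP s)
  | zero => exact zero_mem _
  | add _ _ h₁ h₂ => exact add_mem (h₁ trivial) (h₂ trivial)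
  | smul c _ h => exact Submodule.smul_mem _ c (h trivial)
  | lie x y h₁ h₂ =>
    replace h₁ := h₁ trivial
    replace h₂ := h₂ trivial
    induction h₁ using Submodule.iSup_induction' with
    | mem n x hx =>
      induction h₂ using Submodule.iSup_induction' with
      | mem m y hy => exact Submodule.mem_iSup_of_mem _ (degLP_lie_mem hx hy)
      | zero => rw [lie_zero]; exact zero_mem _
      | add _ _ _ _ h₁ h₂ => rw [lie_add]; exact add_mem (h₁ trivial) (h₂ trivial)
    | zero => rw [zero_lie]; exact zero_mem _
    | add _ _ _ _ h₁ h₂ => rw [add_lie]; exact add_mem (h₁ trivial) (h₂ trivial)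

open TensorProduct LaurentPolynomial in
/-- The homomorphism that records the degree: the bracket is homogeneous for `n - 1`, where `n` is
the degree, hence the exponent. It is a lift, because the subspaces `T ^ (n - 1) ⊗ Lⁿ` satisfy the
bracket relations of the class `𝔓`. -/
theorem exists_gradingHom : ∃ σ : LP K →ₗ⁅K⁆ K[T;T⁻¹] ⊗[K] LP K,
    ∀ n, ∀ x ∈ degLP K n, σ x = (T ((n : ℤ) - 1) : K[T;T⁻¹]) ⊗ₜ[K] x := by
  let ℛ (n : ℕ) : Submodule K (K[T;T⁻¹] ⊗[K] LP K) :=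
    (degLP K n).map (TensorProduct.mk K K[T;T⁻¹] (LP K) (T ((n : ℤ) - 1)))
  obtain ⟨σ, -, hσ⟩ := exists_liftLP (𝒢 := ℛ)
    (r := fun s => (T ((s.degree : ℤ) - 1) : K[T;T⁻¹]) ⊗ₜ[K] gen K s)
    (by
      rintro n m h _ ⟨x, hx, rfl⟩ _ ⟨y, hy, rfl⟩
      refine ⟨⁅x, y⁆, degLP_lie_mem hx hy, ?_⟩
      simp only [TensorProduct.mk_apply]
      rw [LieAlgebra.ExtendScalars.bracket_tmul, ← T_add]
      congr 2
      omega)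
    (by
      rintro _ ⟨x, hx, rfl⟩ _ ⟨y, hy, rfl⟩
      simp only [TensorProduct.mk_apply]
      rw [LieAlgebra.ExtendScalars.bracket_tmul, degLP_zero_lie hx hy, tmul_zero])
    (fun s => Submodule.mem_map_of_mem (gen_mem_degLP s))
  have hmon (t : FreeMagma Gen) :
      σ (monomialLP K t) = (T ((degree t : ℤ) - 1) : K[T;T⁻¹]) ⊗ₜ[K] monomialLP K t := by
    induction t with
    | ih1 s => exact hσ s
    | ih2 y z hy hz =>
      change σ ⁅monomialLP K y, monomialLP K z⁆ =
        (T (((degree y + degree z - 1 : ℕ) : ℤ) - 1) : K[T;T⁻¹]) ⊗ₜ[K]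
          ⁅monomialLP K y, monomialLP K z⁆
      by_cases h : 0 < degree y ∨ 0 < degree z
      · rw [LieHom.map_lie, hy, hz, LieAlgebra.ExtendScalars.bracket_tmul, ← T_add]
        congr 2
        omega
      · have : ⁅monomialLP K y, monomialLP K z⁆ = 0 := by
          refine degLP_zero_lie ?_ ?_
          · convert monomialLP_mem (K := K) y; omega
          · convert monomialLP_mem (K := K) z; omega
        rw [this, map_zero, tmul_zero]
  refine ⟨σ, fun n x hx => ?_⟩
  rw [degLP_eq_span] at hx
  induction hx using Submodule.span_induction with
  | mem x h => obtain ⟨t, rfl, rfl⟩ := h; exact hmon t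
  | zero => simp
  | add _ _ _ _ h₁ h₂ => rw [map_add, h₁, h₂, tmul_add]
  | smul c _ _ h => rw [map_smul, h, tmul_smul]

open TensorProduct LaurentPolynomial in
theorem iSupIndep_degLP : iSupIndep (degLP K) := by
  obtain ⟨σ, hσ⟩ := exists_gradingHom (K := K)
  -- Taking the coefficient of `T ^ (n - 1)` projects onto degree `n`.
  let c (n : ℕ) : K[T;T⁻¹] ⊗[K] LP K →ₗ[K] LP K :=
    (TensorProduct.lid K (LP K)).toLinearMap ∘ₗ
      ((AddMonoidAlgebra.basis ℤ K).coord ((n : ℤ) - 1)).rTensor (LP K)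
  have hc (n m : ℕ) (x : LP K) (hx : x ∈ degLP K m) : c n (σ x) = if m = n then x else 0 := by
    rw [hσ m x hx]
    simp only [c, LinearMap.comp_apply, LinearMap.rTensor_tmul, T]
    rw [← AddMonoidAlgebra.basis_apply, Module.Basis.coord_apply, Module.Basis.repr_self,
      Finsupp.single_apply]
    simp
  intro n
  rw [Submodule.disjoint_def]
  intro x hx hx'
  have h₁ : c n (σ x) = x := by rw [hc n n x hx, if_pos rfl]
  have h₂ : (⨆ m, ⨆ (_ : m ≠ n), degLP K m) ≤ LinearMap.ker (c n ∘ₗ (σ : LP K →ₗ[K] _)) := by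
    refine iSup₂_le fun m hm y hy => ?_
    rw [LinearMap.mem_ker]
    exact (hc n m y hy).trans (if_neg hm)
  rw [← h₁]
  exact h₂ hx'

theorem isClassP_degLP : IsClassP K (degLP K) where
  isInternal := by
    rw [DirectSum.isInternal_submodule_iff_iSupIndep_and_iSup_eq_top]
    exact ⟨iSupIndep_degLP, iSup_degLP⟩
  lie_mem _ _ _ _ hx _ hy := degLP_lie_mem hx hy
  lie_zero _ hx _ hy := degLP_zero_lie hx hy

theorem isFreeOfClassP_LP (K : Type u) [Field K] :
    IsFreeOfClassP.{u, u, 0, w} K (degLP K) Gen.degree (gen K) where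
  isClassP := isClassP_degLP
  gen_mem := gen_mem_degLP
  generates := lieSpan_gen
  existsUnique_lift R _ _ ℛ hℛ r hr := by
    obtain ⟨f, hf, hfr⟩ := exists_liftLP hℛ.lie_mem hℛ.lie_zero hr
    exact ⟨f, ⟨hf, hfr⟩, fun g hg => LP_hom_ext fun s => (hg.2 s).trans (hfr s).symm⟩

end Grading

/-! ### The homomorphism to the model -/

namespace Model

variable {K T : Type*} [Field K] [CommMagma T]

variable (K T) in
/-- The filtration by degree: level `0` is the tree algebra, and `x` lies in level `n + 1` if its
brackets with the elements of the tree algebra lie in level `n`. -/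
def filtration : ℕ → Submodule K (Model K T)
  | 0 =>
    { carrier := {x | x.mom = 0}
      add_mem' := fun {x y} hx hy => by
        rw [Set.mem_ofPred_eq] at hx hy ⊢
        rw [mom_add, hx, hy, add_zero]
      zero_mem' := rfl
      smul_mem' := fun c x hx => by
        rw [Set.mem_ofPred_eq] at hx ⊢
        rw [mom_smul, hx, smul_zero] }
  | n + 1 =>
    { carrier := {x | ∀ u : MonoidAlgebra K T, ⁅x, (⟨u, 0⟩ : Model K T)⁆ ∈ filtration n}
      add_mem' := fun {x y} hx hy u => by rw [add_lie]; exact add_mem (hx u) (hy u)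
      zero_mem' := fun u => by rw [zero_lie]; exact zero_mem _
      smul_mem' := fun c x hx u => by rw [smul_lie]; exact Submodule.smul_mem _ c (hx u) }

theorem mem_filtration_zero {x : Model K T} : x ∈ filtration K T 0 ↔ x.mom = 0 :=
  Iff.rfl

theorem mem_filtration_succ {n : ℕ} {x : Model K T} :
    x ∈ filtration K T (n + 1) ↔ ∀ u, ⁅x, (⟨u, 0⟩ : Model K T)⁆ ∈ filtration K T n :=
  Iff.rfl

theorem filtration_zero_lie {x y : Model K T} (hx : x ∈ filtration K T 0)
    (hy : y ∈ filtration K T 0) : ⁅x, y⁆ = 0 := by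
  rw [mem_filtration_zero] at hx hy
  ext <;> simp [hx, hy]

theorem filtration_succ_lie {n : ℕ} {x y : Model K T} (hx : x ∈ filtration K T (n + 1))
    (hy : y ∈ filtration K T 0) : ⁅x, y⁆ ∈ filtration K T n := by
  have : y = ⟨y.pos, 0⟩ := Model.ext rfl hy
  rw [this]
  exact hx _

/-- The filtration satisfies the bracket relations of the class `𝔓`, by the Jacobi identity
`[[x, y], u] = [x, [y, u]] - [y, [x, u]]`. -/
theorem filtration_lie_mem (n m : ℕ) (h : 0 < n ∨ 0 < m) {x y : Model K T}
    (hx : x ∈ filtration K T n) (hy : y ∈ filtration K T m) :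
    ⁅x, y⁆ ∈ filtration K T (n + m - 1) := by
  induction k : n + m using Nat.strong_induction_on generalizing n m x y with
  | _ k ih =>
    subst k
    match n, m with
    | 0, 0 => simp at h
    | n + 1, 0 => exact filtration_succ_lie hx hy
    | 0, m + 1 =>
      rw [← lie_skew, zero_add]
      exact neg_mem (filtration_succ_lie hy hx)
    | n + 1, m + 1 =>
      change ⁅x, y⁆ ∈ filtration K T (n + 1 + m + 1 - 1)
      rw [show n + 1 + m + 1 - 1 = (n + m) + 1 by omega, mem_filtration_succ]
      intro u
      rw [lie_lie]
      have h₁ := ih (n + 1 + m) (by omega) (n + 1) m (by omega) hx (hy u) rfl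
      have h₂ := ih (m + 1 + n) (by omega) (m + 1) n (by omega) hy (hx u) rfl
      rw [show n + 1 + m - 1 = n + m by omega] at h₁
      rw [show m + 1 + n - 1 = n + m by omega] at h₂
      exact sub_mem h₁ h₂

variable (K) in
/-- The images in the model of `A` and `B`, where `B` goes to the tree `t`. -/
def gens (t : T) : Gen → Model K T
  | .A => ⟨0, FreeLieAlgebra.of K none⟩
  | .B => ⟨MonoidAlgebra.single t 1, 0⟩

theorem gens_mem (t : T) (s : Gen) : gens K t s ∈ filtration K T s.degree := by
  cases s with
  | A =>
    intro u v
    change Model.mom _ = 0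
    simp [gens, treeDer_of_none, treeDer_bracketA, -lie_lie]
  | B => exact mem_filtration_zero.2 rfl

theorem exists_liftModel (t : T) : ∃ Ψ : LP K →ₗ⁅K⁆ Model K T,
    (∀ x ∈ degLP K 0, (Ψ x).mom = 0) ∧ ∀ s, Ψ (gen K s) = gens K t s := by
  obtain ⟨Ψ, h, hs⟩ := exists_liftLP (𝒢 := filtration K T) (r := gens K t)
    (fun n m h x hx y hy => filtration_lie_mem n m h hx hy)
    (fun x hx y hy => filtration_zero_lie hx hy) (gens_mem t)
  exact ⟨Ψ, h 0, hs⟩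

end Model

/-! ### The elements of `X` and the inverse homomorphism -/

section Comparison

variable {K : Type*} [Field K]

instance : CommMagma CommTree where
  mul_comm a b := by
    induction a using Con.induction_on with | _ a =>
    induction b using Con.induction_on with | _ b =>
    exact (Con.eq _).2 (ConGen.Rel.of _ _ ⟨a, b, rfl, rfl⟩)

theorem CommTree.induction {p : CommTree → Prop} (leaf : p CommTree.leaf)
    (mul : ∀ s t, p s → p t → p (s * t)) (t : CommTree) : p t := by
  induction t using Con.induction_on with | _ t =>
  induction t with
  | ih1 _ => exact leaf
  | ih2 a b ha hb => exact mul _ _ ha hb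

theorem starOp_mem {U V : LP K} (hU : U ∈ degLP K 0) (hV : V ∈ degLP K 0) :
    starOp K U V ∈ degLP K 0 :=
  degLP_lie_mem (n := 0) (m := 1) hV (degLP_lie_mem (n := 0) (m := 2) hU (gen_mem_degLP .A))

theorem starOp_comm {U V : LP K} (hU : U ∈ degLP K 0) (hV : V ∈ degLP K 0) :
    starOp K U V = starOp K V U := by
  rw [starOp, starOp, leibniz_lie, degLP_zero_lie hV hU, zero_lie, zero_add]

variable (K) in
/-- The value at `B` of a formal product, with `*` for the product. -/
def starMonomial : FreeMagma Unit → LP K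
  | .of _ => gen K .B
  | .mul a b => starOp K (starMonomial a) (starMonomial b)

theorem starMonomial_mem (a : FreeMagma Unit) : starMonomial K a ∈ degLP K 0 := by
  induction a with
  | ih1 _ => exact gen_mem_degLP .B
  | ih2 a b ha hb => exact starOp_mem ha hb

variable (K) in
/-- The element of `X` given by a tree: `starMonomial` respects the commutativity of the product, as
`*` is commutative in degree `0`. -/
def treeElt (t : CommTree) : LP K :=
  Con.liftOn t (starMonomial K) fun a b h => by
    change ConGen.Rel _ a b at h
    induction h with
    | of a b h =>
      obtain ⟨s, t, rfl, rfl⟩ := h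
      exact starOp_comm (starMonomial_mem s) (starMonomial_mem t)
    | refl => rfl
    | symm _ h => exact h.symm
    | trans _ _ h₁ h₂ => exact h₁.trans h₂
    | @mul a b c d _ _ h₁ h₂ =>
      exact congrArg₂ (starOp K) h₁ h₂

theorem treeElt_leaf : treeElt K CommTree.leaf = gen K .B :=
  rfl

theorem treeElt_mul (s t : CommTree) :
    treeElt K (s * t) = starOp K (treeElt K s) (treeElt K t) := by
  induction s using Con.induction_on with | _ a =>
  induction t using Con.induction_on with | _ b =>
  rfl

theorem treeElt_mem (t : CommTree) : treeElt K t ∈ degLP K 0 := by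
  induction t using Con.induction_on with | _ a =>
  exact starMonomial_mem a

theorem range_treeElt : Set.range (treeElt K) = setX K := by
  ext U
  constructor
  · rintro ⟨t, rfl⟩
    induction t using CommTree.induction with
    | leaf => exact MemX.base
    | mul s t hs ht => rw [treeElt_mul]; exact MemX.star _ _ hs ht
  · intro hU
    induction hU with
    | base => exact ⟨CommTree.leaf, rfl⟩
    | star U V _ _ hU hV =>
      obtain ⟨s, rfl⟩ := hU
      obtain ⟨t, rfl⟩ := hV
      exact ⟨s * t, treeElt_mul s t⟩

variable (K) in
/-- The linear extension of `treeElt` to the free commutative nonassociative algebra. -/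
def treeMap : FreeCommAlg K →ₗ[K] LP K :=
  (MonoidAlgebra.basis CommTree K).constr K (treeElt K)

theorem treeMap_single (t : CommTree) :
    treeMap K (MonoidAlgebra.single t 1) = treeElt K t := by
  rw [← MonoidAlgebra.basis_apply, treeMap, Module.Basis.constr_basis]

theorem range_treeMap : LinearMap.range (treeMap K) = spanX K := by
  rw [treeMap, Module.Basis.constr_range, range_treeElt, spanX]

theorem treeMap_mem (u : FreeCommAlg K) : treeMap K u ∈ degLP K 0 := by
  induction u using treeAlg_induction with
  | single t => rw [treeMap_single]; exact treeElt_mem t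
  | zero => rw [map_zero]; exact zero_mem _
  | add u v hu hv => rw [map_add]; exact add_mem hu hv
  | smul c u hu => rw [map_smul]; exact Submodule.smul_mem _ c hu

theorem treeMap_mul (u v : FreeCommAlg K) :
    treeMap K (u * v) = starOp K (treeMap K u) (treeMap K v) := by
  unfold starOp
  induction u using treeAlg_induction with
  | single s =>
    induction v using treeAlg_induction with
    | single t =>
      rw [MonoidAlgebra.single_mul_single, mul_one, treeMap_single, treeMap_single, treeMap_single,
        treeElt_mul, starOp]
    | zero => simp
    | add u v hu hv => rw [mul_add, map_add, map_add, add_lie, hu, hv]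
    | smul c u hu => rw [mul_smul_comm, map_smul, map_smul, smul_lie, hu]
  | zero => simp
  | add u v hu hv => rw [add_mul, map_add, map_add, add_lie, lie_add, hu, hv]
  | smul c u hu => rw [smul_mul_assoc, map_smul, map_smul, smul_lie, lie_smul, hu]

variable (K) in
/-- The homomorphism from the free Lie algebra on `A` and the `[t, A]` to `L_𝔓(A, B)`. -/
def momMap : FreeLieAlgebra K (Option CommTree) →ₗ⁅K⁆ LP K :=
  FreeLieAlgebra.lift K fun s => s.elim (gen K .A) fun t => ⁅treeElt K t, gen K .A⁆

theorem momMap_none : momMap K (FreeLieAlgebra.of K none) = gen K .A := by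
  simp [momMap]

theorem momMap_some (t : CommTree) :
    momMap K (FreeLieAlgebra.of K (some t)) = ⁅treeElt K t, gen K .A⁆ := by
  simp [momMap]

theorem momMap_bracketA (u : FreeCommAlg K) :
    momMap K (bracketA u) = ⁅treeMap K u, gen K .A⁆ := by
  induction u using treeAlg_induction with
  | single t => rw [bracketA_single, treeMap_single, momMap_some]
  | zero => simp
  | add u v hu hv => rw [map_add, map_add, map_add, hu, hv, add_lie]
  | smul c u hu => rw [map_smul, map_smul, map_smul, hu, smul_lie]

/-- The mixed bracket of the model is the one of `L_𝔓(A, B)`. -/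
theorem momMap_lie_treeMap (f : FreeLieAlgebra K (Option CommTree)) (u : FreeCommAlg K) :
    ⁅momMap K f, treeMap K u⁆ = treeMap K ⁅f, u⁆ + momMap K (treeDer K CommTree f u) := by
  induction f using freeLie_induction generalizing u with
  | of s =>
    cases s with
    | none =>
      rw [of_none_lie, treeDer_of_none, map_zero, zero_add, map_neg, momMap_bracketA, momMap_none,
        lie_skew]
    | some t =>
      rw [of_some_lie, treeDer_of_some, LinearMap.zero_apply, map_zero, add_zero, map_neg,
        treeMap_mul, treeMap_single, momMap_some, starOp,
        lie_skew]
  | zero => simp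
  | add f g hf hg => simp only [map_add, add_lie, LinearMap.add_apply, hf, hg]; abel
  | smul c f hf => simp only [map_smul, smul_lie, LinearMap.smul_apply, hf, smul_add]
  | lie f g hf hg =>
    rw [LieHom.map_lie, lie_lie, hf, hg, lie_add, lie_add, hf, hg, treeDer_lie]
    simp only [lie_lie, map_sub, LieHom.map_lie]
    abel

variable (K) in
/-- The homomorphism from the model to `L_𝔓(A, B)`. -/
def ofModel : Model K CommTree →ₗ⁅K⁆ LP K where
  toFun x := treeMap K x.pos + momMap K x.mom
  map_add' x y := by simp only [Model.pos_add, Model.mom_add, map_add]; abel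
  map_smul' c x := by simp
  map_lie' {x y} := by
    simp only [Model.pos_lie, Model.mom_lie, map_sub, map_add, lie_add, add_lie, LieHom.map_lie,
      momMap_lie_treeMap, degLP_zero_lie (treeMap_mem x.pos) (treeMap_mem y.pos)]
    rw [← lie_skew (treeMap K x.pos) (momMap K y.mom), momMap_lie_treeMap]
    abel

theorem ofModel_apply (x : Model K CommTree) :
    ofModel K x = treeMap K x.pos + momMap K x.mom :=
  rfl

/-- `L_𝔓(A, B)` is isomorphic to the model over the free commutative magma on one generator. -/
theorem exists_modelEquiv : ∃ Ψ : LP K ≃ₗ⁅K⁆ Model K CommTree,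
    (∀ x ∈ degLP K 0, (Ψ x).mom = 0) ∧ ∀ x, Ψ.symm x = treeMap K x.pos + momMap K x.mom := by
  obtain ⟨Ψ, hΨ, hgen⟩ := Model.exists_liftModel (K := K) CommTree.leaf
  have hA : Ψ (gen K .A) = ⟨0, FreeLieAlgebra.of K none⟩ := hgen .A
  have h₁ : (ofModel K).comp Ψ = LieHom.id := by
    refine LP_hom_ext fun s => ?_
    rw [LieHom.comp_apply, hgen, ofModel_apply]
    cases s with
    | A => simp [Model.gens, momMap_none]
    | B => simp [Model.gens, treeMap_single, treeElt_leaf]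
  have htree (t : CommTree) : Ψ (treeElt K t) = ⟨MonoidAlgebra.single t 1, 0⟩ := by
    induction t using CommTree.induction with
    | leaf => exact hgen .B
    | mul s t hs ht =>
      rw [treeElt_mul, starOp, LieHom.map_lie, LieHom.map_lie, hs, ht, hA]
      ext
      · simp [treeDer_of_none, bracketA_single, of_some_lie, MonoidAlgebra.single_mul_single]
      · simp [treeDer_of_none, treeDer_of_some, bracketA_single, of_none_lie]
  have hpos (u : FreeCommAlg K) : Ψ (treeMap K u) = ⟨u, 0⟩ := by
    induction u using treeAlg_induction with
    | single t => rw [treeMap_single, htree]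
    | zero => rw [map_zero, map_zero]; rfl
    | add u v hu hv => rw [map_add, map_add, hu, hv]; ext <;> simp
    | smul c u hu => rw [map_smul, map_smul, hu]; ext <;> simp
  have hmom (f : FreeLieAlgebra K (Option CommTree)) : Ψ (momMap K f) = ⟨0, f⟩ := by
    induction f using freeLie_induction with
    | of s =>
      cases s with
      | none => rw [momMap_none, hA]
      | some t =>
        rw [momMap_some, LieHom.map_lie, htree, hA]
        ext <;> simp [treeDer_of_none, bracketA_single, of_none_lie]
    | zero => rw [map_zero, map_zero]; rfl
    | add u v hu hv => rw [map_add, map_add, hu, hv]; ext <;> simp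
    | smul c u hu => rw [map_smul, map_smul, hu]; ext <;> simp
    | lie f g hf hg => rw [LieHom.map_lie, LieHom.map_lie, hf, hg]; ext <;> simp
  refine ⟨{ Ψ with
    invFun := ofModel K
    left_inv := fun x => LieHom.congr_fun h₁ x
    right_inv := fun x => ?_ }, hΨ, fun x => rfl⟩
  change Ψ (treeMap K x.pos + momMap K x.mom) = x
  rw [map_add, hpos, hmom]
  ext <;> simp

end Comparison

/-! ### The structure of the Lie algebra of classical mechanics -/

section Final

variable {K : Type*} [Field K]

theorem range_freeGen_lift : (FreeLieAlgebra.lift K (freeGen K)).range = subalgAXA K := by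
  rw [range_lift, subalgAXA]
  congr 1
  ext z
  constructor
  · rintro ⟨_ | U, rfl⟩
    · exact Or.inl rfl
    · exact Or.inr ⟨U, U.2, rfl⟩
  · rintro (rfl | ⟨U, hU, rfl⟩)
    · exact ⟨none, rfl⟩
    · exact ⟨some ⟨U, hU⟩, rfl⟩

theorem treeMap_injective : Function.Injective (treeMap K) := by
  obtain ⟨Ψ, -, hΨ⟩ := exists_modelEquiv (K := K)
  intro u v h
  have : Ψ.symm ⟨u, 0⟩ = Ψ.symm ⟨v, 0⟩ := by simp [hΨ, h]
  exact congrArg Model.pos (Ψ.symm.injective this)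

theorem momMap_injective : Function.Injective (momMap K) := by
  obtain ⟨Ψ, -, hΨ⟩ := exists_modelEquiv (K := K)
  intro u v h
  have : Ψ.symm ⟨0, u⟩ = Ψ.symm ⟨0, v⟩ := by simp [hΨ, h]
  exact congrArg Model.mom (Ψ.symm.injective this)

theorem treeElt_injective : Function.Injective (treeElt K) := fun s t h => by
  rw [← treeMap_single, ← treeMap_single] at h
  exact MonoidAlgebra.single_left_injective one_ne_zero (treeMap_injective h)

variable (K) in
/-- The bijection between the trees and `X`. -/
def treeEquiv : CommTree ≃ setX K :=
  (Equiv.ofInjective _ treeElt_injective).trans (Equiv.setCongr range_treeElt)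

theorem coe_treeEquiv (t : CommTree) : (treeEquiv K t : LP K) = treeElt K t :=
  rfl

/-- Up to the bijection `treeEquiv` of the generators, `momMap` is the homomorphism from the free
Lie algebra on `A` and the `[U, A]`, `U ∈ X`. -/
theorem momMap_comp : (momMap K).comp (FreeLieAlgebra.lift K fun s : Option (setX K) =>
    FreeLieAlgebra.of K (s.map (treeEquiv K).symm)) = FreeLieAlgebra.lift K (freeGen K) := by
  ext s
  rw [LieHom.comp_apply, FreeLieAlgebra.lift_of_apply, FreeLieAlgebra.lift_of_apply]
  cases s with
  | none => exact momMap_none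
  | some U =>
    rw [Option.map_some, momMap_some, ← coe_treeEquiv, Equiv.apply_symm_apply]
    rfl

theorem lift_freeGen_injective : Function.Injective (FreeLieAlgebra.lift K (freeGen K)) := by
  rw [← momMap_comp]
  refine momMap_injective.comp (Function.LeftInverse.injective
    (g := FreeLieAlgebra.lift K fun s : Option CommTree =>
      FreeLieAlgebra.of K (s.map (treeEquiv K))) fun x => ?_)
  have h : (FreeLieAlgebra.lift K fun s : Option CommTree =>
      FreeLieAlgebra.of K (s.map (treeEquiv K))).comp (FreeLieAlgebra.lift K
        fun s : Option (setX K) => FreeLieAlgebra.of K (s.map (treeEquiv K).symm)) =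
      LieHom.id := by
    ext s
    cases s <;> simp
  exact LieHom.congr_fun h x

theorem range_momMap : (momMap K).range = subalgAXA K := by
  rw [← range_freeGen_lift, momMap, range_lift, range_lift]
  congr 1
  ext z
  constructor
  · rintro ⟨_ | t, rfl⟩
    · exact ⟨none, rfl⟩
    · exact ⟨some (treeEquiv K t), rfl⟩
  · rintro ⟨_ | U, rfl⟩
    · exact ⟨none, rfl⟩
    · refine ⟨some ((treeEquiv K).symm U), ?_⟩
      change ⁅treeElt K _, gen K .A⁆ = ⁅(U : LP K), gen K .A⁆
      rw [← coe_treeEquiv, Equiv.apply_symm_apply]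

theorem isCompl_spanX : IsCompl (spanX K) (subalgAXA K).toSubmodule := by
  obtain ⟨Ψ, -, hΨ⟩ := exists_modelEquiv (K := K)
  rw [← range_treeMap, ← range_momMap]
  constructor
  · rw [Submodule.disjoint_def]
    rintro _ ⟨u, rfl⟩ ⟨f, hf⟩
    replace hf : momMap K f = treeMap K u := hf
    have : Ψ.symm ⟨u, -f⟩ = Ψ.symm 0 := by simp [hΨ, hf]
    rw [show u = 0 from congrArg Model.pos (Ψ.symm.injective this), map_zero]
  · rw [codisjoint_iff, eq_top_iff]
    intro x _
    rw [← Ψ.symm_apply_apply x, hΨ]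
    exact add_mem (Submodule.mem_sup_left ⟨_, rfl⟩) (Submodule.mem_sup_right ⟨_, rfl⟩)

theorem spanX_eq_degLP : spanX K = degLP K 0 := by
  obtain ⟨Ψ, h₀, hΨ⟩ := exists_modelEquiv (K := K)
  rw [← range_treeMap]
  apply le_antisymm
  · rintro _ ⟨u, rfl⟩
    exact treeMap_mem u
  · intro x hx
    refine ⟨(Ψ x).pos, ?_⟩
    conv_rhs => rw [← Ψ.symm_apply_apply x, hΨ, h₀ x hx, map_zero, add_zero]

theorem exists_freeCommAlg_equiv : ∃ φ : FreeCommAlg K ≃ₗ[K] spanX K,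
      (φ (MonoidAlgebra.single CommTree.leaf 1) : LP K) = gen K .B ∧
      (∀ u v : FreeCommAlg K, (φ (u * v) : LP K) = starOp K (φ u) (φ v)) ∧
      Set.range (fun t : CommTree => (φ (MonoidAlgebra.single t 1) : LP K)) = setX K := by
  let φ : FreeCommAlg K ≃ₗ[K] spanX K :=
    (LinearEquiv.ofInjective (treeMap K) treeMap_injective).trans
      (LinearEquiv.ofEq _ _ range_treeMap)
  have hφ (u : FreeCommAlg K) : (φ u : LP K) = treeMap K u := rfl
  refine ⟨φ, ?_, fun u v => ?_, ?_⟩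
  · rw [hφ, treeMap_single, treeElt_leaf]
  · rw [hφ, hφ, hφ, treeMap_mul]
  · simp only [hφ, treeMap_single]
    exact range_treeElt

end Final

end ClassicalMech

end

open ClassicalMech in
theorem theorem1 (K : Type u) [Field K] :
    -- `L(A, B) / I` is the free Lie algebra in the class `𝔓` with `A`, `B` of degrees 2 and 0
    IsFreeOfClassP.{u, u, 0, w} K (degLP K) Gen.degree (gen K) ∧
    -- `L_𝔓(A, B) = span(X) ⊕ L(A, [X, A])` as vector spaces
    IsCompl (spanX K) (subalgAXA K).toSubmodule ∧
    -- `span(X)` is abelian and is the part of degree 0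
    (∀ U ∈ spanX K, ∀ V ∈ spanX K, ⁅U, V⁆ = 0) ∧
    spanX K = degLP K 0 ∧
    -- `span(X)` under `*` is the free commutative nonassociative algebra generated by `B`,
    -- the trees being in bijection with `X`
    (∃ φ : FreeCommAlg K ≃ₗ[K] spanX K,
      (φ (MonoidAlgebra.single CommTree.leaf 1) : LP K) = gen K .B ∧
      (∀ u v : FreeCommAlg K, (φ (u * v) : LP K) = starOp K (φ u) (φ v)) ∧
      Set.range (fun t : CommTree => (φ (MonoidAlgebra.single t 1) : LP K)) = setX K) ∧
    -- the second summand is the free Lie algebra over `A` and the `[U, A]`, `U ∈ X`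
    Function.Injective (FreeLieAlgebra.lift K (freeGen K)) ∧
    (FreeLieAlgebra.lift K (freeGen K)).range = subalgAXA K := by
  refine ⟨isFreeOfClassP_LP K, isCompl_spanX, fun U hU V hV => ?_, spanX_eq_degLP,
    exists_freeCommAlg_equiv, lift_freeGen_injective, range_freeGen_lift⟩
  rw [spanX_eq_degLP] at hU hV
  exact degLP_zero_lie hU hV
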